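/- Consider the complete network on $n\ge 2$ nodes $v_1,\dots,v_n$, in which every source $v_i$ ($i<n$) sends one unsplittable flow to the destination $v_n$. In the randomized failover scheme $\mathbf{RFS}$, each source $v_i$ independently draws a uniformly random permutation $\delta_{i,1},\dots,\delta_{i,n-2}$ of $V\setminus\{v_i,v_n\}$. After a set $F$ of bidirectional links has failed, the flow of $v_i$, at its current node $u$ (initially $u=v_i$), uses the link $\{u,v_n\}$ if that link has not failed; otherwise it goes on to the next node of the sequence $\delta_{i,\cdot}$ (after the current position) whose link to $u$ has not failed, and it stops if there is none. The load of a link is the number of flows crossing it (in either direction), and the maximum load is $\widehat\lambda=\max_e\lambda(e)$. For every constant $c>0$ there is a constant $C>0$ such that for all $n\ge 2$, with probability at least $1-n^{-c}$ over the random permutations, the following holds: for every $\varphi$ with $1<\varphi<n$ and every set $F$ of failed links, possibly chosen with full knowledge of the permutations, if the failure of $F$ creates a maximum load $\widehat\lambda\ge\sqrt{\varphi}$, then $|F|\ge C\,\varphi/\log_2 n$. -/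

import Mathlib

open MeasureTheory ProbabilityTheory

/-- The links of the full mesh on `n` nodes: all unordered pairs of distinct nodes. -/
def meshLinks (n : ℕ) : Finset (Sym2 (Fin n)) :=
  (⊤ : SimpleGraph (Fin n)).edgeFinset

/-- The sources (one flow per source): all nodes other than the destination. -/
abbrev Source {n : ℕ} (dest : Fin n) : Type := {v : Fin n // v ≠ dest}

/-- A failover sequence of a source: an enumeration without repetition of all nodes other than
the source and the destination (there are `n - 2` of them). -/
abbrev BackupOrder {n : ℕ} (dest : Fin n) (src : Source dest) : Type :=
  Fin (n - 2) ≃ {v : Fin n // v ≠ src.1 ∧ v ≠ dest}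

instance {n : ℕ} (dest : Fin n) (src : Source dest) : MeasurableSpace (BackupOrder dest src) := ⊤

/-- A failover matrix: one failover sequence (row) per source. -/
abbrev FailoverMatrix {n : ℕ} (dest : Fin n) : Type :=
  (src : Source dest) → BackupOrder dest src

/-- The row of a source, as the list of its backup nodes in order. -/
def FailoverMatrix.row {n : ℕ} {dest : Fin n} (δ : FailoverMatrix dest) (src : Source dest) :
    List (Fin n) :=
  List.ofFn fun j => (δ src j).1

/-- The links crossed by a flow that is at node `u`, when `backups` is the part of its failover
sequence that has not been tried yet and the links in `F` have failed. The link to the destination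
is used whenever it is available. Otherwise the backup nodes are tried in order: one that cannot be
reached over its link from `u` is skipped, and the flow moves to the first one that can. A flow
that runs out of backup nodes is stuck, and the links it has crossed so far are counted. -/
def linksFrom {n : ℕ} (dest : Fin n) (F : Finset (Sym2 (Fin n))) :
    Fin n → List (Fin n) → List (Sym2 (Fin n))
  | u, [] => if s(u, dest) ∈ F then [] else [s(u, dest)]
  | u, x :: backups =>
      if s(u, dest) ∈ F then
        if s(u, x) ∈ F then linksFrom dest F u backups
        else s(u, x) :: linksFrom dest F x backups
      else [s(u, dest)]

/-- The load of the link `e` after the failure of `F`: the number of flows that cross `e`. -/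
def load {n : ℕ} {dest : Fin n} (δ : FailoverMatrix dest) (F : Finset (Sym2 (Fin n)))
    (e : Sym2 (Fin n)) : ℕ :=
  (Finset.univ.filter fun src : Source dest => e ∈ linksFrom dest F src.1 (δ.row src)).card

/-- The maximum load of a link after the failure of `F`. -/
def maxLoad {n : ℕ} {dest : Fin n} (δ : FailoverMatrix dest) (F : Finset (Sym2 (Fin n))) : ℕ :=
  (meshLinks n).sup (load δ F)

/-- The randomized failover scheme: the rows are independent (product measure), each of them
uniform among all failover sequences of its source. -/
noncomputable def rfs {n : ℕ} (dest : Fin n) : Measure (FailoverMatrix dest) :=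
  Measure.pi fun src => uniformOn (Set.univ : Set (BackupOrder dest src))

/-! Let a link `e` carry load l ≥ √φ, and let w ≠ `dest` be an endpoint of it. Every flow crossing
`e`, except w's own, has w in its row, and each entry before w touches `F`: it was skipped or left
because of a failed link. Put t ≈ l/2 and L = ⌊t/12⌋. Either w is among the first L entries of t
rows, or t rows have their first L entries inside the at most 2|F| nodes touching `F`
(`exists_sources_of_load`). Union bounds over nodes, node sets and sets of rows make the first event
unlikely, and the second too for sets of about tL/(2 log n) nodes; hence |F| is at least of order
t²/log n. Neither event mentions `F` or φ, so an adversary who sees the permutations is covered. For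
t = O(log n) these bounds are too weak, but there `load_le_card_add_one` suffices. -/

/-! ### Counting permutations. -/

/-- Once L entries lie in X, at most |X| - L ≤ (N - L)/2 of the N - L unused values are in X, so
each further entry costs a factor 1/2. -/
theorem two_pow_mul_card_prefix_subset_le {N : ℕ} {β : Type*} [Fintype β] [DecidableEq β]
    (X : Finset β) (hX : 2 * X.card ≤ N) (L : ℕ) (hL : L ≤ N) :
    2 ^ L * (Finset.univ.filter fun σ : Fin N ≃ β => ∀ j : Fin N, j.1 < L → σ j ∈ X).card ≤
      Fintype.card (Fin N ≃ β) := by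
  induction L with
  | zero => simp [Finset.card_univ]
  | succ L ih =>
    refine le_trans ?_ (ih (by omega))
    rw [pow_succ, mul_assoc]
    refine Nat.mul_le_mul_left _ ?_
    set E := Finset.univ.filter fun σ : Fin N ≃ β => ∀ j : Fin N, j.1 < L → σ j ∈ X with hE
    set E' := Finset.univ.filter fun σ : Fin N ≃ β => ∀ j : Fin N, j.1 < L + 1 → σ j ∈ X with hE'
    let K : Finset (Fin N) := Finset.univ.filter fun k => L ≤ k.1
    let k₀ : Fin N := ⟨L, by omega⟩
    have hlow : (Finset.univ.filter fun k : Fin N => k.1 < L).card = L := by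
      rw [Fin.card_filter_val_lt]; omega
    have hK : K.card + L = N := by
      have := Finset.card_filter_add_card_filter_not (s := (Finset.univ : Finset (Fin N)))
        (fun k => k.1 < L)
      simp only [not_lt, Finset.card_univ, Fintype.card_fin] at this
      rw [hlow] at this
      have h2 : K.card = (Finset.univ.filter fun k : Fin N => L ≤ k.1).card := rfl
      omega
    -- By symmetry, position L may be exchanged with any later position k; averaging over k replaces
    -- conditioning.
    have hswap : ∀ k ∈ K, E'.card = (E.filter fun τ => τ k ∈ X).card := by
      intro k hk
      have hk' : L ≤ k.1 := (Finset.mem_filter.1 hk).2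
      refine Finset.card_bij (fun σ _ => (Equiv.swap k₀ k).trans σ) ?_ ?_ ?_
      · intro σ hσ
        simp only [hE', Finset.mem_filter, Finset.mem_univ, true_and] at hσ
        simp only [hE, Finset.mem_filter, Finset.mem_univ, true_and, Equiv.trans_apply,
          Equiv.swap_apply_right]
        refine ⟨fun j hj => ?_, hσ k₀ (by simp [k₀])⟩
        rw [Equiv.swap_apply_of_ne_of_ne]
        · exact hσ j (by omega)
        · rintro rfl; simp [k₀] at hj
        · rintro rfl; omega
      · intro σ _ τ _ h
        ext x
        have := congrArg (fun e : Fin N ≃ β => e (Equiv.swap k₀ k x)) h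
        simpa using this
      · intro τ hτ
        simp only [hE, Finset.mem_filter, Finset.mem_univ, true_and] at hτ
        refine ⟨(Equiv.swap k₀ k).trans τ, ?_, ?_⟩
        · simp only [hE', Finset.mem_filter, Finset.mem_univ, true_and, Equiv.trans_apply]
          intro j hj
          by_cases hjk : j = k₀
          · subst hjk; simpa using hτ.2
          · have hjL : j.1 < L := by
              have : j.1 ≠ L := fun h => hjk (Fin.ext h)
              omega
            rw [Equiv.swap_apply_of_ne_of_ne hjk]
            · exact hτ.1 j hjL
            · rintro rfl; omega
        · ext x; simp
    have hsum : K.card * E'.card = ∑ τ ∈ E, (K.filter fun k => τ k ∈ X).card := by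
      calc K.card * E'.card = ∑ k ∈ K, E'.card := by simp
        _ = ∑ k ∈ K, (E.filter fun τ => τ k ∈ X).card := Finset.sum_congr rfl hswap
        _ = _ := by
          simp only [Finset.card_filter]
          exact Finset.sum_comm
    have hτ : ∀ τ ∈ E, 2 * (K.filter fun k => τ k ∈ X).card ≤ K.card := by
      intro τ hτ
      simp only [hE, Finset.mem_filter, Finset.mem_univ, true_and] at hτ
      have h1 : ((K.filter fun k => τ k ∈ X) ∪
          (Finset.univ.filter fun k : Fin N => k.1 < L)).card ≤ X.card := by
        refine Finset.card_le_card_of_injOn τ ?_ τ.injective.injOn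
        intro k hk
        simp only [Finset.coe_union, Set.mem_union, Finset.mem_coe, Finset.mem_filter,
          Finset.mem_univ, true_and] at hk
        rcases hk with hk | hk
        · exact hk.2
        · exact hτ k hk
      rw [Finset.card_union_of_disjoint, hlow] at h1
      · omega
      · rw [Finset.disjoint_left]
        intro k hk hk'
        simp only [K, Finset.mem_filter, Finset.mem_univ, true_and] at hk hk'
        omega
    have hfin : K.card * (2 * E'.card) ≤ K.card * E.card := by
      calc K.card * (2 * E'.card) = 2 * (K.card * E'.card) := by ring
        _ = ∑ τ ∈ E, 2 * (K.filter fun k => τ k ∈ X).card := by rw [hsum, Finset.mul_sum]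
        _ ≤ ∑ τ ∈ E, K.card := Finset.sum_le_sum hτ
        _ = K.card * E.card := by simp [mul_comm]
    exact Nat.le_of_mul_le_mul_left hfin (by omega)

theorem mul_card_position_lt_le {N : ℕ} {β : Type*} [Fintype β] [DecidableEq β]
    (w : β) (L : ℕ) :
    N * (Finset.univ.filter fun σ : Fin N ≃ β => ∃ j : Fin N, j.1 < L ∧ σ j = w).card ≤
      L * Fintype.card (Fin N ≃ β) := by
  have hone : ∀ j : Fin N, N * (Finset.univ.filter fun σ : Fin N ≃ β => σ j = w).card =
      Fintype.card (Fin N ≃ β) := by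
    intro j
    have hswap : ∀ k : Fin N, (Finset.univ.filter fun σ : Fin N ≃ β => σ j = w).card =
        (Finset.univ.filter fun σ : Fin N ≃ β => σ k = w).card := by
      intro k
      refine Finset.card_bij (fun σ _ => (Equiv.swap j k).trans σ) ?_ ?_ ?_
      · intro σ hσ; simpa using hσ
      · intro σ _ τ _ h
        ext x
        have := congrArg (fun e : Fin N ≃ β => e (Equiv.swap j k x)) h
        simpa using this
      · intro τ hτ
        exact ⟨(Equiv.swap j k).trans τ, by simpa using hτ, by ext x; simp⟩
    calc N * (Finset.univ.filter fun σ : Fin N ≃ β => σ j = w).card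
        = ∑ k : Fin N, (Finset.univ.filter fun σ : Fin N ≃ β => σ j = w).card := by simp
      _ = ∑ k : Fin N, (Finset.univ.filter fun σ : Fin N ≃ β => σ k = w).card :=
          Finset.sum_congr rfl fun k _ => hswap k
      _ = ∑ σ : Fin N ≃ β, (Finset.univ.filter fun k : Fin N => σ k = w).card := by
          simp only [Finset.card_filter]
          exact Finset.sum_comm
      _ = ∑ σ : Fin N ≃ β, 1 := by
          refine Finset.sum_congr rfl fun σ _ => ?_
          rw [Finset.card_eq_one]
          exact ⟨σ.symm w, by ext k; simp [Equiv.eq_symm_apply]⟩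
      _ = _ := by simp
  let J : Finset (Fin N) := Finset.univ.filter fun j => j.1 < L
  have hJ : J.card ≤ L := by
    simp only [J]
    rw [Fin.card_filter_val_lt]; omega
  calc N * (Finset.univ.filter fun σ : Fin N ≃ β => ∃ j : Fin N, j.1 < L ∧ σ j = w).card
      ≤ N * (J.biUnion fun j => Finset.univ.filter fun σ : Fin N ≃ β => σ j = w).card := by
        refine Nat.mul_le_mul_left _ (Finset.card_le_card fun σ hσ => ?_)
        simpa [J] using hσ
    _ ≤ N * ∑ j ∈ J, (Finset.univ.filter fun σ : Fin N ≃ β => σ j = w).card :=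
        Nat.mul_le_mul_left _ Finset.card_biUnion_le
    _ = ∑ j ∈ J, Fintype.card (Fin N ≃ β) := by
        rw [Finset.mul_sum]; exact Finset.sum_congr rfl fun j _ => hone j
    _ ≤ L * Fintype.card (Fin N ≃ β) := by
        rw [Finset.sum_const, smul_eq_mul]; exact Nat.mul_le_mul_right _ hJ

/-! ### Probabilities for one row and for independent rows. -/

theorem uniformOn_univ_real_setOf {Ω : Type*} [Fintype Ω] [MeasurableSpace Ω]
    [MeasurableSingletonClass Ω] (p : Ω → Prop) [DecidablePred p] :
    (uniformOn (Set.univ : Set Ω)).real {x | p x} =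
      (Finset.univ.filter p).card / Fintype.card Ω := by
  have h : {x | p x} = ((Finset.univ.filter p : Finset Ω) : Set Ω) := by ext; simp
  rw [measureReal_def, uniformOn_univ, h, Measure.count_apply_finset]
  simp

theorem measureReal_pi_forall_mem_le {ι : Type*} [Fintype ι] {Ω : ι → Type*}
    [∀ i, MeasurableSpace (Ω i)] (μ : ∀ i, Measure (Ω i)) [∀ i, IsProbabilityMeasure (μ i)]
    (R : Finset ι) (A : ∀ i, Set (Ω i)) (p : ℝ) (hA : ∀ i ∈ R, (μ i).real (A i) ≤ p) :
    (Measure.pi μ).real {x | ∀ i ∈ R, x i ∈ A i} ≤ p ^ R.card := by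
  classical
  have h : {x : ∀ i, Ω i | ∀ i ∈ R, x i ∈ A i} =
      Set.pi Set.univ fun i => if i ∈ R then A i else Set.univ := by
    ext x
    simp only [Set.mem_ofPred_eq, Set.mem_pi, Set.mem_univ, true_implies]
    refine forall_congr' fun i => ?_
    by_cases hi : i ∈ R <;> simp [hi]
  rw [measureReal_def, h, Measure.pi_pi, ENNReal.toReal_prod]
  have h2 : ∀ i, (μ i (if i ∈ R then A i else Set.univ)).toReal =
      if i ∈ R then (μ i).real (A i) else 1 := by
    intro i
    by_cases hi : i ∈ R <;> simp [hi, measureReal_def]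
  simp only [h2]
  rw [Finset.prod_ite_mem, Finset.univ_inter]
  exact (Finset.prod_le_prod (fun _ _ => measureReal_nonneg) hA).trans_eq (by simp)

instance {n : ℕ} (dest : Fin n) (src : Source dest) :
    MeasurableSingletonClass (BackupOrder dest src) := ⟨fun _ => trivial⟩

theorem card_backup_nodes {n : ℕ} (dest : Fin n) (src : Source dest) :
    Fintype.card {v : Fin n // v ≠ src.1 ∧ v ≠ dest} = n - 2 := by
  rw [Fintype.card_subtype]
  have h : (Finset.univ.filter fun v : Fin n => v ≠ src.1 ∧ v ≠ dest) =
      Finset.univ \ {src.1, dest} := by ext; simp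
  rw [h, Finset.card_sdiff_of_subset (Finset.subset_univ _), Finset.card_pair src.2]
  simp

instance {n : ℕ} (dest : Fin n) (src : Source dest) : Nonempty (BackupOrder dest src) :=
  ⟨(Fintype.equivFinOfCardEq (card_backup_nodes dest src)).symm⟩

instance {n : ℕ} (dest : Fin n) (src : Source dest) :
    IsProbabilityMeasure (uniformOn (Set.univ : Set (BackupOrder dest src))) :=
  isProbabilityMeasure_uniformOn Set.finite_univ Set.univ_nonempty

instance {n : ℕ} (dest : Fin n) : IsProbabilityMeasure (rfs dest) := by
  unfold rfs; infer_instance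

theorem uniformOn_prefix_subset_le {n : ℕ} (dest : Fin n) (src : Source dest)
    (X : Finset (Fin n)) (L : ℕ) (hX : 2 * X.card ≤ n - 2) (hL : L ≤ n - 2) :
    (uniformOn (Set.univ : Set (BackupOrder dest src))).real
      {σ | ∀ j, j.1 < L → (σ j).1 ∈ X} ≤ (1 / 2) ^ L := by
  classical
  rw [uniformOn_univ_real_setOf, div_le_iff₀ (by exact_mod_cast Fintype.card_pos)]
  have hc : (X.subtype fun v => v ≠ src.1 ∧ v ≠ dest).card ≤ X.card := by
    rw [Finset.card_subtype]; exact Finset.card_filter_le _ _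
  have h := two_pow_mul_card_prefix_subset_le (N := n - 2)
    (X.subtype fun v => v ≠ src.1 ∧ v ≠ dest) (by omega) L hL
  simp only [Finset.mem_subtype] at h
  have h' : (2 : ℝ) ^ L * ((Finset.univ.filter fun σ : BackupOrder dest src =>
      ∀ j, j.1 < L → (σ j).1 ∈ X).card : ℝ) ≤ Fintype.card (BackupOrder dest src) := by
    exact_mod_cast h
  rw [one_div, inv_pow, inv_mul_eq_div, le_div_iff₀ (by positivity)]
  linarith

theorem uniformOn_position_lt_le {n : ℕ} (hn : 2 < n) (dest : Fin n) (src : Source dest)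
    (w : Fin n) (L : ℕ) :
    (uniformOn (Set.univ : Set (BackupOrder dest src))).real
      {σ | ∃ j, j.1 < L ∧ (σ j).1 = w} ≤ L / (n - 2 : ℕ) := by
  classical
  by_cases hw : w ≠ src.1 ∧ w ≠ dest
  · rw [uniformOn_univ_real_setOf, div_le_div_iff₀ (by exact_mod_cast Fintype.card_pos)
      (by exact_mod_cast (by omega : 0 < n - 2))]
    have h := mul_card_position_lt_le (N := n - 2)
      (⟨w, hw⟩ : {v : Fin n // v ≠ src.1 ∧ v ≠ dest}) L
    simp only [Subtype.ext_iff] at h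
    have h' : ((n - 2 : ℕ) : ℝ) * ((Finset.univ.filter fun σ : BackupOrder dest src =>
      ∃ j, j.1 < L ∧ (σ j).1 = w).card : ℝ) ≤ L * Fintype.card (BackupOrder dest src) := by
      exact_mod_cast h
    linarith
  · have : {σ : BackupOrder dest src | ∃ j, j.1 < L ∧ (σ j).1 = w} = ∅ := by
      ext σ
      simp only [Set.mem_ofPred_eq, Set.mem_empty_iff_false, iff_false, not_exists, not_and]
      rintro j - rfl
      exact hw (σ j).2
    rw [this, measureReal_empty]
    positivity

/-! ### Deterministic analysis of routes. -/

theorem eq_of_mem_linksFrom {n : ℕ} {dest : Fin n} {F : Finset (Sym2 (Fin n))} {u : Fin n}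
    {l : List (Fin n)} {e : Sym2 (Fin n)} (hu : s(u, dest) ∉ F) (he : e ∈ linksFrom dest F u l) :
    e = s(u, dest) := by
  cases l <;> simpa [linksFrom, hu] using he

theorem exists_split_of_mem_linksFrom {n : ℕ} {dest : Fin n} {F : Finset (Sym2 (Fin n))}
    {e : Sym2 (Fin n)} {w : Fin n} (hwe : w ∈ e) (hwd : w ≠ dest) (l : List (Fin n)) :
    ∀ u, w ≠ u → e ∈ linksFrom dest F u l →
      ∃ l₁ l₂, l = l₁ ++ w :: l₂ ∧ ∀ x ∈ l₁, ∃ f ∈ F, x ∈ f := by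
  have hno : ∀ u, w ≠ u → e ≠ s(u, dest) := by
    rintro u hu rfl
    rcases Sym2.mem_iff.1 hwe with h | h
    exacts [hu h, hwd h]
  induction l with
  | nil =>
    intro u hu he
    by_cases h : s(u, dest) ∈ F
    · simp [linksFrom, h] at he
    · exact absurd (eq_of_mem_linksFrom h he) (hno u hu)
  | cons x l ih =>
    intro u hu he
    by_cases h : s(u, dest) ∈ F
    · by_cases hx : s(u, x) ∈ F
      · simp only [linksFrom, h, hx, if_true] at he
        obtain ⟨l₁, l₂, rfl, hl⟩ := ih u hu he
        refine ⟨x :: l₁, l₂, rfl, ?_⟩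
        simp only [List.mem_cons, forall_eq_or_imp]
        exact ⟨⟨_, hx, by simp⟩, hl⟩
      · simp only [linksFrom, h, hx, if_true, if_false, List.mem_cons] at he
        by_cases hwx : w = x
        · subst hwx
          exact ⟨[], l, rfl, by simp⟩
        rcases he with rfl | he
        · rcases Sym2.mem_iff.1 hwe with h | h
          exacts [absurd h hu, absurd h hwx]
        · obtain ⟨l₁, l₂, rfl, hl⟩ := ih x hwx he
          have hxd : s(x, dest) ∈ F := by
            by_contra hxd
            exact hno x hwx (eq_of_mem_linksFrom hxd he)
          refine ⟨x :: l₁, l₂, rfl, ?_⟩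
          simp only [List.mem_cons, forall_eq_or_imp]
          exact ⟨⟨_, hxd, by simp⟩, hl⟩
    · exact absurd (eq_of_mem_linksFrom h he) (hno u hu)

theorem exists_position_of_mem_linksFrom {n : ℕ} {dest : Fin n} {F : Finset (Sym2 (Fin n))}
    {e : Sym2 (Fin n)} {w : Fin n} (hwe : w ∈ e) (hwd : w ≠ dest) (δ : FailoverMatrix dest)
    (src : Source dest) (hws : w ≠ src.1) (he : e ∈ linksFrom dest F src.1 (δ.row src)) :
    ∃ j, (δ src j).1 = w ∧ ∀ i < j, ∃ f ∈ F, (δ src i).1 ∈ f := by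
  obtain ⟨l₁, l₂, hl, hF⟩ := exists_split_of_mem_linksFrom hwe hwd _ _ hws he
  have hlen : l₁.length < n - 2 := by
    have := congrArg List.length hl
    simp [FailoverMatrix.row] at this
    omega
  have hget : ∀ (i : ℕ) (hi : i < n - 2), (l₁ ++ w :: l₂)[i]? = some (δ src ⟨i, hi⟩).1 := by
    intro i hi
    rw [← hl, FailoverMatrix.row, List.getElem?_ofFn]
    simp [hi]
  refine ⟨⟨l₁.length, hlen⟩, ?_, fun i hi => hF _ ?_⟩
  · have := hget _ hlen
    simp at this
    exact this.symm
  · have hi' : i.1 < l₁.length := hi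
    have := hget i.1 i.2
    rw [List.getElem?_append_left hi'] at this
    exact List.mem_of_getElem? this

/-- A flow whose direct link survives crosses only that link, so the direct links of the flows
crossing `e` are distinct members of `F` ∪ {`e`}. -/
theorem load_le_card_add_one {n : ℕ} {dest : Fin n} (δ : FailoverMatrix dest)
    (F : Finset (Sym2 (Fin n))) (e : Sym2 (Fin n)) : load δ F e ≤ F.card + 1 := by
  classical
  refine le_trans ?_ (Finset.card_insert_le e F)
  refine Finset.card_le_card_of_injOn (fun src => s(src.1, dest)) ?_ ?_
  · intro src hsrc
    simp only [Finset.coe_filter, Finset.mem_univ, true_and, Set.mem_ofPred_eq] at hsrc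
    by_cases h : s(src.1, dest) ∈ F
    · simp [h]
    · simp [← eq_of_mem_linksFrom h hsrc]
  · intro a _ b _ h
    simp only [Sym2.eq_iff] at h
    rcases h with h | h
    · exact Subtype.ext h.1
    · exact absurd h.1 a.2

/-- The nodes incident to a link of `F`. -/
def incidentNodes {n : ℕ} (F : Finset (Sym2 (Fin n))) : Finset (Fin n) :=
  F.biUnion Sym2.toFinset

theorem mem_incidentNodes {n : ℕ} {F : Finset (Sym2 (Fin n))} {x : Fin n} :
    x ∈ incidentNodes F ↔ ∃ f ∈ F, x ∈ f := by
  simp [incidentNodes]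

theorem card_incidentNodes_le {n : ℕ} (F : Finset (Sym2 (Fin n))) :
    (incidentNodes F).card ≤ F.card * 2 := by
  refine Finset.card_biUnion_le_card_mul _ _ _ fun f _ => ?_
  induction f with
  | _ a b =>
    rw [Sym2.toFinset_mk_eq]
    exact Finset.card_le_two

theorem exists_sources_of_load {n : ℕ} {dest : Fin n} (δ : FailoverMatrix dest)
    (F : Finset (Sym2 (Fin n))) {e : Sym2 (Fin n)} (he : e ∈ meshLinks n) {t L : ℕ}
    (ht : 2 * t + 1 ≤ load δ F e)
    (hpos : ∀ w : Fin n, ∀ R : Finset (Source dest), R.card = t →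
      ¬ ∀ src ∈ R, ∃ j, j.1 < L ∧ (δ src j).1 = w) :
    ∃ R : Finset (Source dest), R.card = t ∧
      ∀ src ∈ R, ∀ j, j.1 < L → (δ src j).1 ∈ incidentNodes F := by
  classical
  obtain ⟨w, hwe, hwd⟩ : ∃ w ∈ e, w ≠ dest := by
    induction e with
    | _ a b =>
      have hab : a ≠ b := by simpa [meshLinks] using he
      by_cases ha : a = dest
      · exact ⟨b, by simp, fun hb => hab (ha.trans hb.symm)⟩
      · exact ⟨a, by simp, ha⟩
  set S := Finset.univ.filter fun src : Source dest => e ∈ linksFrom dest F src.1 (δ.row src)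
    with hS
  have hScard : 2 * t + 1 ≤ S.card := ht
  -- The flow of w starts at w, so its row says nothing; this is the +1 in 2t + 1.
  set S₁ := S.erase ⟨w, hwd⟩ with hS₁
  have hS₁card : 2 * t ≤ S₁.card := by
    have : S.card - 1 ≤ S₁.card := Finset.pred_card_le_card_erase
    omega
  set N := S₁.filter fun src => ∃ j, j.1 < L ∧ (δ src j).1 = w with hN
  have hNcard : N.card ≤ t := by
    by_contra! h
    obtain ⟨R, hRN, hR⟩ := Finset.exists_subset_card_eq h.le
    exact hpos w R hR fun src hsrc => (Finset.mem_filter.1 (hRN hsrc)).2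
  have hrest : t ≤ (S₁.filter fun src => ¬ ∃ j, j.1 < L ∧ (δ src j).1 = w).card := by
    have : N.card + (S₁.filter fun src => ¬ ∃ j, j.1 < L ∧ (δ src j).1 = w).card = S₁.card :=
      Finset.card_filter_add_card_filter_not _
    omega
  obtain ⟨R, hRsub, hR⟩ := Finset.exists_subset_card_eq hrest
  refine ⟨R, hR, fun src hsrc j hj => ?_⟩
  obtain ⟨h1, h2⟩ := Finset.mem_filter.1 (hRsub hsrc)
  obtain ⟨h3, h4⟩ := Finset.mem_erase.1 h1
  have h5 := (Finset.mem_filter.1 h4).2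
  obtain ⟨k, hk, hlt⟩ := exists_position_of_mem_linksFrom hwe hwd δ src
    (fun h => h3 (Subtype.ext h.symm)) h5
  have hkL : L ≤ k.1 := by
    by_contra! h
    exact h2 ⟨k, h, hk⟩
  exact mem_incidentNodes.2 (hlt j (Fin.lt_def.2 (hj.trans_le hkL)))

/-! ### Union bounds for the exceptional matrices. -/

/-- The matrices in which some node is among the first `L` entries of some `t` rows. -/
def frequentPrefixNode {n : ℕ} (dest : Fin n) (t L : ℕ) : Set (FailoverMatrix dest) :=
  {δ | ∃ w : Fin n, ∃ R : Finset (Source dest), R.card = t ∧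
    ∀ src ∈ R, ∃ j, j.1 < L ∧ (δ src j).1 = w}

/-- The matrices in which some `m` nodes contain the first `L` entries of some `t` rows. -/
def concentratedPrefixes {n : ℕ} (dest : Fin n) (t L m : ℕ) : Set (FailoverMatrix dest) :=
  {δ | ∃ X : Finset (Fin n), X.card = m ∧ ∃ R : Finset (Source dest), R.card = t ∧
    ∀ src ∈ R, ∀ j, j.1 < L → (δ src j).1 ∈ X}

theorem card_source_le {n : ℕ} (dest : Fin n) : Fintype.card (Source dest) ≤ n := by
  simp

theorem rfs_frequentPrefixNode_le {n : ℕ} (hn : 4 ≤ n) (dest : Fin n) {t L : ℕ}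
    (hL : 12 * L ≤ t) :
    (rfs dest).real (frequentPrefixNode dest t L) ≤ n * (1 / 2) ^ t := by
  classical
  set I := (Finset.univ : Finset (Fin n)) ×ˢ
    Finset.powersetCard t (Finset.univ : Finset (Source dest)) with hI
  have hsub : frequentPrefixNode dest t L ⊆ ⋃ i ∈ I, {δ : FailoverMatrix dest | ∀ src ∈ i.2,
      δ src ∈ {σ : BackupOrder dest src | ∃ j, j.1 < L ∧ (σ j).1 = i.1}} := by
    rintro δ ⟨w, R, hR, h⟩
    simp only [Set.mem_iUnion]
    exact ⟨(w, R), by simp [hI, hR], h⟩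
  have hterm : ∀ i ∈ I, (rfs dest).real {δ : FailoverMatrix dest | ∀ src ∈ i.2,
      δ src ∈ {σ : BackupOrder dest src | ∃ j, j.1 < L ∧ (σ j).1 = i.1}} ≤
        ((L : ℝ) / (n - 2 : ℕ)) ^ t := by
    intro i hi
    have hcard : i.2.card = t := by simpa [hI] using hi
    rw [← hcard]
    exact measureReal_pi_forall_mem_le _ _ _ _ fun src _ =>
      uniformOn_position_lt_le (by omega) dest src i.1 L
  have hIcard : (I.card : ℝ) ≤ n * ((n : ℝ) ^ t / t.factorial) := by
    rw [hI, Finset.card_product, Finset.card_powersetCard, Finset.card_univ, Finset.card_univ,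
      Fintype.card_fin, Nat.cast_mul]
    refine mul_le_mul_of_nonneg_left ?_ (by positivity)
    exact (Nat.cast_le.2 (Nat.choose_le_choose t (card_source_le dest))).trans
      (Nat.choose_le_pow_div t n)
  -- The 12 splits as 2 · 6: n ≤ 2(n - 2), and 6 beats t^t/t! ≤ e^t ≤ 3^t with a factor 1/2 to
  -- spare.
  have hratio : (n : ℝ) * (L / (n - 2 : ℕ)) ≤ t / 6 := by
    have h2 : (0 : ℝ) < (n - 2 : ℕ) := by exact_mod_cast (by omega : 0 < n - 2)
    have h3 : (n : ℝ) ≤ 2 * (n - 2 : ℕ) := by exact_mod_cast (by omega : n ≤ 2 * (n - 2))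
    have h4 : (12 : ℝ) * L ≤ t := by exact_mod_cast hL
    rw [← mul_div_assoc, div_le_iff₀ h2]
    have : (n : ℝ) * L ≤ 2 * (n - 2 : ℕ) * L := by gcongr
    nlinarith
  calc (rfs dest).real (frequentPrefixNode dest t L)
      ≤ _ := measureReal_mono hsub (measure_ne_top _ _)
    _ ≤ ∑ i ∈ I, _ := measureReal_biUnion_finset_le _ _
    _ ≤ ∑ i ∈ I, ((L : ℝ) / (n - 2 : ℕ)) ^ t := Finset.sum_le_sum hterm
    _ = I.card * ((L : ℝ) / (n - 2 : ℕ)) ^ t := by simp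
    _ ≤ n * ((n : ℝ) ^ t / t.factorial) * ((L : ℝ) / (n - 2 : ℕ)) ^ t := by gcongr
    _ = n * (((n : ℝ) * (L / (n - 2 : ℕ))) ^ t / t.factorial) := by rw [mul_pow]; ring
    _ ≤ n * (((t : ℝ) / 6) ^ t / t.factorial) := by gcongr
    _ = n * ((1 / 6) ^ t * ((t : ℝ) ^ t / t.factorial)) := by rw [div_pow, div_pow]; ring
    _ ≤ n * ((1 / 6) ^ t * 3 ^ t) := by
        gcongr
        refine (Real.pow_div_factorial_le_exp (t : ℝ) (by positivity) t).trans ?_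
        rw [← Real.exp_one_pow]
        exact pow_le_pow_left₀ (Real.exp_pos 1).le Real.exp_one_lt_three.le t
    _ = n * (1 / 2) ^ t := by rw [← mul_pow]; norm_num

theorem rfs_concentratedPrefixes_le {n : ℕ} (dest : Fin n) {t L m : ℕ}
    (hL : L ≤ n - 2) (hm : 2 * m ≤ n - 2) :
    (rfs dest).real (concentratedPrefixes dest t L m) ≤
      (n : ℝ) ^ (t + m) * (1 / 2) ^ (t * L) := by
  classical
  set I := Finset.powersetCard m (Finset.univ : Finset (Fin n)) ×ˢ
    Finset.powersetCard t (Finset.univ : Finset (Source dest)) with hI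
  have hsub : concentratedPrefixes dest t L m ⊆ ⋃ i ∈ I, {δ : FailoverMatrix dest | ∀ src ∈ i.2,
      δ src ∈ {σ : BackupOrder dest src | ∀ j, j.1 < L → (σ j).1 ∈ i.1}} := by
    rintro δ ⟨X, hX, R, hR, h⟩
    simp only [Set.mem_iUnion]
    exact ⟨(X, R), by simp [hI, hR, hX], h⟩
  have hterm : ∀ i ∈ I, (rfs dest).real {δ : FailoverMatrix dest | ∀ src ∈ i.2,
      δ src ∈ {σ : BackupOrder dest src | ∀ j, j.1 < L → (σ j).1 ∈ i.1}} ≤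
        ((1 / 2 : ℝ) ^ L) ^ t := by
    intro i hi
    have hcard : i.1.card = m ∧ i.2.card = t := by simpa [hI] using hi
    rw [← hcard.2]
    exact measureReal_pi_forall_mem_le _ _ _ _ fun src _ =>
      uniformOn_prefix_subset_le dest src i.1 L (by omega) hL
  have hchoose : ∀ k r : ℕ, k ≤ n → ((k.choose r : ℕ) : ℝ) ≤ (n : ℝ) ^ r := fun k r hk => by
    exact_mod_cast (Nat.choose_le_choose r hk).trans (Nat.choose_le_pow n r)
  have hIcard : (I.card : ℝ) ≤ (n : ℝ) ^ (t + m) := by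
    rw [hI, Finset.card_product, Finset.card_powersetCard, Finset.card_powersetCard,
      Finset.card_univ, Finset.card_univ, Fintype.card_fin, Nat.cast_mul, pow_add, mul_comm]
    exact mul_le_mul (hchoose _ _ (card_source_le dest)) (hchoose _ _ le_rfl) (by positivity)
      (by positivity)
  calc (rfs dest).real (concentratedPrefixes dest t L m)
      ≤ _ := measureReal_mono hsub (measure_ne_top _ _)
    _ ≤ ∑ i ∈ I, _ := measureReal_biUnion_finset_le _ _
    _ ≤ ∑ i ∈ I, ((1 / 2 : ℝ) ^ L) ^ t := Finset.sum_le_sum hterm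
    _ = I.card * (1 / 2 : ℝ) ^ (t * L) := by rw [← pow_mul, mul_comm L t]; simp
    _ ≤ _ := by gcongr

/-- A number of nodes too small to contain the first `t / 12` entries of `t` rows. -/
noncomputable def nodeBudget (n t : ℕ) : ℕ := ⌊(t : ℝ) * (t / 12 : ℕ) / (2 * Real.logb 2 n)⌋₊

/-- The matrices excluded by the union bound at level `t`. -/
def exceptional {n : ℕ} (dest : Fin n) (t : ℕ) : Set (FailoverMatrix dest) :=
  frequentPrefixNode dest t (t / 12) ∪ concentratedPrefixes dest t (t / 12) (nodeBudget n t)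

theorem one_le_logb_two {n : ℕ} (hn : 2 ≤ n) : 1 ≤ Real.logb 2 n := by
  rw [Real.le_logb_iff_rpow_le (by norm_num) (by positivity)]
  simpa using (by exact_mod_cast hn : (2 : ℝ) ≤ n)

theorem half_pow_le_rpow {n : ℕ} (hn : 2 ≤ n) {a : ℝ} {k : ℕ} (h : a * Real.logb 2 n ≤ k) :
    (1 / 2 : ℝ) ^ k ≤ (n : ℝ) ^ (-a) := by
  have hn0 : (0 : ℝ) < n := by positivity
  calc (1 / 2 : ℝ) ^ k = (2 : ℝ) ^ (-(k : ℝ)) := by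
        rw [Real.rpow_neg (by norm_num), Real.rpow_natCast, one_div, inv_pow]
    _ ≤ (2 : ℝ) ^ (Real.logb 2 n * -a) :=
        Real.rpow_le_rpow_of_exponent_le (by norm_num) (by linarith)
    _ = (n : ℝ) ^ (-a) := by
        rw [Real.rpow_mul (by norm_num), Real.rpow_logb (by norm_num) (by norm_num) hn0]

theorem div_twentyfour_le_div_twelve {t : ℕ} (ht : 24 ≤ t) : (t : ℝ) / 24 ≤ (t / 12 : ℕ) := by
  rw [div_le_iff₀ (by norm_num)]
  exact_mod_cast (by omega : t ≤ t / 12 * 24)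

/-- `nodeBudget` makes n^m cost at most half of the exponent tL; since L ≥ 4 log n, the other half
pays for n^(t + c + 2). -/
theorem rfs_exceptional_le {n : ℕ} (hn : 2 ≤ n) (dest : Fin n) {t : ℕ} {c : ℝ} (hc : 0 < c)
    (ht : (c + 1540) * Real.logb 2 n ≤ t) (htn : 4 * t ^ 2 ≤ n) :
    (rfs dest).real (exceptional dest t) ≤ 2 * (n : ℝ) ^ (-(c + 2)) := by
  have hlg := one_le_logb_two hn
  have hn0 : (0 : ℝ) < n := by positivity
  set lg := Real.logb 2 n with hlgdef
  have ht1 : c + 1540 ≤ t := by nlinarith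
  have ht2 : 1540 ≤ t := by
    have : ((1540 : ℕ) : ℝ) ≤ t := by push_cast; linarith
    exact_mod_cast this
  have htn' : t ≤ n := by nlinarith
  have hL1 : (t : ℝ) / 24 ≤ (t / 12 : ℕ) := div_twentyfour_le_div_twelve (by omega)
  have hL2 : 12 * (t / 12) ≤ t := Nat.mul_div_le t 12
  have hm1 : (nodeBudget n t : ℝ) * (2 * lg) ≤ t * (t / 12 : ℕ) := by
    rw [← le_div_iff₀ (by positivity)]
    exact Nat.floor_le (by positivity)
  have hm2 : 2 * nodeBudget n t ≤ n - 2 := by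
    have h1 : (12 * (t / 12 : ℕ) : ℝ) ≤ t := by exact_mod_cast hL2
    have h2 : (4 * t ^ 2 : ℝ) ≤ n := by exact_mod_cast htn
    have h3 : (nodeBudget n t : ℝ) * 2 ≤ nodeBudget n t * (2 * lg) := by
      have : (0 : ℝ) ≤ nodeBudget n t := by positivity
      nlinarith
    have h4 : (4 * nodeBudget n t : ℝ) ≤ n := by nlinarith
    have h5 : 4 * nodeBudget n t ≤ n := by exact_mod_cast h4
    omega
  have hfreq := rfs_frequentPrefixNode_le (by omega) dest hL2
  have hconc := rfs_concentratedPrefixes_le dest (t := t) (L := t / 12) (by omega) hm2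
  have hfreq' : n * (1 / 2 : ℝ) ^ t ≤ (n : ℝ) ^ (-(c + 2)) := by
    calc n * (1 / 2 : ℝ) ^ t ≤ n * (n : ℝ) ^ (-(c + 3)) := by
          gcongr
          exact half_pow_le_rpow hn (by nlinarith)
      _ = (n : ℝ) ^ (-(c + 2)) := by
          rw [show -(c + 2) = 1 + -(c + 3) by ring, Real.rpow_add hn0, Real.rpow_one]
  have hconc' : (n : ℝ) ^ (t + nodeBudget n t) * (1 / 2 : ℝ) ^ (t * (t / 12)) ≤
      (n : ℝ) ^ (-(c + 2)) := by
    calc (n : ℝ) ^ (t + nodeBudget n t) * (1 / 2 : ℝ) ^ (t * (t / 12))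
        ≤ (n : ℝ) ^ (t + nodeBudget n t) *
          (n : ℝ) ^ (-(c + 2 + (t + nodeBudget n t : ℕ))) := by
          gcongr
          refine half_pow_le_rpow hn ?_
          push_cast
          have h1 : 4 * lg ≤ (t / 12 : ℕ) := by nlinarith
          have h2 : t * (4 * lg) ≤ (t : ℝ) * (t / 12 : ℕ) := by gcongr
          have h3 : (c + 2) * lg ≤ t * lg := by
            refine mul_le_mul_of_nonneg_right ?_ (by linarith)
            linarith
          have h4 : (0 : ℝ) ≤ t * lg := by positivity
          rw [← hlgdef]
          nlinarith
      _ = (n : ℝ) ^ (-(c + 2)) := by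
          rw [← Real.rpow_natCast, ← Real.rpow_add hn0]
          congr 1
          ring
  calc (rfs dest).real (exceptional dest t) ≤ _ := measureReal_union_le _ _
    _ ≤ _ := by linarith

/-! ### From non-exceptional matrices to the bound on |F|. -/

theorem card_ge_of_not_mem_exceptional {n : ℕ} (hn : 2 ≤ n) {dest : Fin n} {c : ℝ} (hc : 0 < c)
    {δ : FailoverMatrix dest}
    (hδ : ∀ t : ℕ, (c + 1540) * Real.logb 2 n ≤ t → 4 * t ^ 2 ≤ n → δ ∉ exceptional dest t)
    {φ : ℝ} (h1 : 1 < φ) (hφn : φ < n) {F : Finset (Sym2 (Fin n))}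
    (hload : √φ ≤ (maxLoad δ F : ℝ)) :
    1 / (4 * (c + 1541)) * (φ / Real.logb 2 n) ≤ (F.card : ℝ) := by
  have hlg := one_le_logb_two hn
  set lg := Real.logb 2 n with hlgdef
  have hsqrt : 1 < √φ := by rw [Real.lt_sqrt (by norm_num)]; linarith
  have hsq : √φ ^ 2 = φ := Real.sq_sqrt (by linarith)
  set l := ⌈√φ⌉₊ with hl
  have hl1 : √φ ≤ l := Nat.le_ceil _
  have hl2 : (l : ℝ) < √φ + 1 := Nat.ceil_lt_add_one (by linarith)
  have hl3 : 2 ≤ l := by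
    have : ((1 : ℕ) : ℝ) < l := by push_cast; linarith
    have : 1 < l := by exact_mod_cast this
    omega
  have hφl : φ ≤ (l : ℝ) ^ 2 := by rw [← hsq]; gcongr
  obtain ⟨e, he, hle⟩ : ∃ e ∈ meshLinks n, l ≤ load δ F e :=
    (Finset.le_sup_iff (by simp; omega)).1 (Nat.ceil_le.2 hload)
  obtain ⟨t, ht1, ht2⟩ : ∃ t, 2 * t + 1 ≤ l ∧ l ≤ 2 * t + 2 := ⟨(l - 1) / 2, by omega, by omega⟩
  have ht1' : (2 * t + 1 : ℝ) ≤ l := by exact_mod_cast ht1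
  have ht2' : (l : ℝ) ≤ 2 * t + 2 := by exact_mod_cast ht2
  rw [one_div_mul_eq_div, div_div, div_le_iff₀ (by positivity)]
  have hl3' : (2 : ℝ) ≤ l := by exact_mod_cast hl3
  by_cases ht : (c + 1540) * lg ≤ t
  -- From 2t + 1 ≤ l < √φ + 1 follows 4t² < φ < n.
  · have htn : 4 * t ^ 2 ≤ n := by
      have : (4 * t ^ 2 : ℝ) ≤ n := by nlinarith
      exact_mod_cast this
    have hnot := hδ t ht htn
    have hfreq : δ ∉ frequentPrefixNode dest t (t / 12) := fun h => hnot (Or.inl h)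
    have hconc : δ ∉ concentratedPrefixes dest t (t / 12) (nodeBudget n t) :=
      fun h => hnot (Or.inr h)
    obtain ⟨R, hR, hRX⟩ := exists_sources_of_load δ F he (ht1.trans hle)
      fun w R hR h => hfreq ⟨w, R, hR, h⟩
    have ht3 : (1540 : ℝ) ≤ t := by nlinarith
    have ht4 : 24 ≤ t := by
      have : ((24 : ℕ) : ℝ) ≤ t := by push_cast; linarith
      exact_mod_cast this
    have hL1 := div_twentyfour_le_div_twelve ht4
    have hX : nodeBudget n t < (incidentNodes F).card := by
      by_contra! hle
      have hbudget : nodeBudget n t ≤ Fintype.card (Fin n) := by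
        rw [Fintype.card_fin]
        have h1 : (12 * (t / 12 : ℕ) : ℝ) ≤ t := by exact_mod_cast Nat.mul_div_le t 12
        have h2 : (4 * t ^ 2 : ℝ) ≤ n := by exact_mod_cast htn
        refine Nat.floor_le_of_le ?_
        rw [div_le_iff₀ (by positivity)]
        nlinarith
      -- `concentratedPrefixes` wants exactly the budgeted size, so the incident nodes are padded.
      obtain ⟨X, hX, hXcard⟩ := Finset.exists_superset_card_eq hle hbudget
      exact hconc ⟨X, hXcard, R, hR, fun src hsrc j hj => hX (hRX src hsrc j hj)⟩
    have hF : nodeBudget n t + 1 ≤ F.card * 2 := hX.trans_le (card_incidentNodes_le F)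
    have hF' : (nodeBudget n t + 1 : ℝ) ≤ F.card * 2 := by exact_mod_cast hF
    have hfloor : (t : ℝ) * (t / 12 : ℕ) / (2 * lg) < nodeBudget n t + 1 :=
      Nat.lt_floor_add_one _
    rw [div_lt_iff₀ (by positivity)] at hfloor
    have h5 : (t : ℝ) * (t / 24) ≤ t * (t / 12 : ℕ) := by gcongr
    have h6 : (nodeBudget n t + 1 : ℝ) * (2 * lg) ≤ F.card * 2 * (2 * lg) := by gcongr
    have h7 : (t : ℝ) ^ 2 ≤ 96 * (F.card * lg) := by nlinarith
    have h8 : φ ≤ 16 * (t : ℝ) ^ 2 := by nlinarith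
    have h9 : (0 : ℝ) ≤ F.card * lg := by positivity
    -- Here φ ≤ 16 · 96 · |F| log n, and 1536 ≤ 4(c + 1541).
    nlinarith
  · push Not at ht
    have hF : l ≤ F.card + 1 := hle.trans (load_le_card_add_one δ F e)
    have hF' : (l : ℝ) ≤ F.card + 1 := by exact_mod_cast hF
    have h3 : (l : ℝ) ≤ 2 * ((c + 1541) * lg) := by nlinarith
    -- Uses l ≥ 2, which comes from φ > 1.
    have h4 : (l : ℝ) ≤ 2 * F.card := by linarith
    calc φ ≤ (l : ℝ) * l := by rw [← sq]; exact hφl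
      _ ≤ (2 * F.card) * (2 * ((c + 1541) * lg)) := by gcongr
      _ = _ := by ring

theorem theorem4 (c : ℝ) (hc : 0 < c) :
    ∃ C : ℝ, 0 < C ∧ ∀ n : ℕ, 2 ≤ n → ∀ dest : Fin n,
      1 - 1 / (n : ℝ) ^ c ≤
        (rfs dest).real {δ : FailoverMatrix dest |
          ∀ φ : ℝ, 1 < φ → φ < n →
            ∀ F : Finset (Sym2 (Fin n)), F ⊆ meshLinks n →
              √φ ≤ (maxLoad δ F : ℝ) → C * (φ / Real.logb 2 n) ≤ (F.card : ℝ)} := by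
  classical
  refine ⟨1 / (4 * (c + 1541)), by positivity, fun n hn dest => ?_⟩
  set G := {δ : FailoverMatrix dest | ∀ φ : ℝ, 1 < φ → φ < n →
    ∀ F : Finset (Sym2 (Fin n)), F ⊆ meshLinks n → √φ ≤ (maxLoad δ F : ℝ) →
      1 / (4 * (c + 1541)) * (φ / Real.logb 2 n) ≤ (F.card : ℝ)} with hG
  set T := (Finset.range n).filter fun t : ℕ =>
    (c + 1540) * Real.logb 2 n ≤ t ∧ 4 * t ^ 2 ≤ n with hT
  have hn0 : (0 : ℝ) < n := by positivity
  have hcover : (Set.univ : Set (FailoverMatrix dest)) ⊆ G ∪ ⋃ t ∈ T, exceptional dest t := by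
    intro δ _
    by_cases h : δ ∈ ⋃ t ∈ T, exceptional dest t
    · exact Or.inr h
    · refine Or.inl fun φ h1 hφ F _ hload =>
        card_ge_of_not_mem_exceptional hn hc (fun t ht htn hmem => h ?_) h1 hφ hload
      simp only [Set.mem_iUnion]
      exact ⟨t, by simp only [hT, Finset.mem_filter, Finset.mem_range]
                   exact ⟨by nlinarith, ht, htn⟩, hmem⟩
  have hunion : (rfs dest).real (⋃ t ∈ T, exceptional dest t) ≤ 1 / (n : ℝ) ^ c := by
    calc (rfs dest).real (⋃ t ∈ T, exceptional dest t)
        ≤ ∑ t ∈ T, (rfs dest).real (exceptional dest t) := measureReal_biUnion_finset_le _ _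
      _ ≤ ∑ t ∈ T, 2 * (n : ℝ) ^ (-(c + 2)) := by
          refine Finset.sum_le_sum fun t ht => ?_
          obtain ⟨-, ht1, ht2⟩ := Finset.mem_filter.1 ht
          exact rfs_exceptional_le hn dest hc ht1 ht2
      _ = T.card * (2 * (n : ℝ) ^ (-(c + 2))) := by simp
      -- One factor n counts the levels t, the other absorbs the 2; hence the exponent c + 2.
      _ ≤ n * (n * (n : ℝ) ^ (-(c + 2))) := by
          gcongr
          · simpa using Finset.card_filter_le (Finset.range n) _
          · exact_mod_cast hn
      _ = 1 / (n : ℝ) ^ c := by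
          rw [neg_add, Real.rpow_add hn0, Real.rpow_neg hn0.le, Real.rpow_neg hn0.le,
            Real.rpow_two]
          field_simp
  have h1 : (1 : ℝ) ≤ (rfs dest).real G + (rfs dest).real (⋃ t ∈ T, exceptional dest t) := by
    calc (1 : ℝ) = (rfs dest).real Set.univ := by simp
      _ ≤ _ := measureReal_mono hcover
      _ ≤ _ := measureReal_union_le _ _
  linarith
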